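/- **Conventions.** Let $n\ge 1$. A plurisubharmonic function on a domain $D\subset\mathbb C^n$ is an upper semicontinuous $u:D\to[-\infty,\infty)$, $u\not\equiv-\infty$, satisfying the sub-mean value inequality on every closed affine complex disc contained in $D$; $\operatorname{PSH}(D)$ is the set of such functions. For a topological space $X$, a convex cone $F\subset C(X)$ of real continuous functions containing the constants, $g\in C(X)$ and $z\in X$, let $J^F_z(X)$ be the set of Borel probability measures $\mu$ on $X$ with compact support in $X$ such that $f(z)\le\int_X f\,d\mu$ for all $f\in F$, and put, with values in $[-\infty,\infty]$, $$Sg(z)=\sup\{f(z): f\in F,\ f\le g\},\qquad Ig(z)=\inf\Big\{\int_X g\,d\mu:\ \mu\in J^F_z(X)\Big\}.$$ The non-compact version of Edwards' theorem for $X$ is the assertion that for all such $F$ and $g$, either $Sg\equiv-\infty$ or $Sg=Ig$ on $X$. **Statement.** Let $D\subset\mathbb C^n$ be an open ball and $V$ an open ball with $\overline V\subset D$. Let $$u_{D,V}(z)=\sup\{v(z): v\in\operatorname{PSH}(D),\ v\le-\chi_V \text{ on } D\}.$$ 1. There exists $u\in\operatorname{PSH}(D)$, $u\le 0$, such that $\{u=-\infty\}\cap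 V$ is dense in $V$. 2. $u_{D,V}<0$ on $D\setminus\overline V$. 3. Let $u$ be any function as in 1. For real $m>0$ put $U_m=\{u/m<-1\}\cap V$, $D'_m=D\setminus\partial U_m$ and $g_m=-\chi_{U_m}$ on $D'_m$, and let $F$ be the set of restrictions to $D'_m$ of the functions in $\operatorname{PSH}(D)\cap C(\overline D)$. Then for every $m>0$: $D'_m$ is open and contains $D\setminus\overline V$, $F$ is a convex cone in $C(D'_m)$ containing the constants, $g_m\in C(D'_m)$, and $Sg_m(z)\ne-\infty$ for all $z\in D'_m$. If $Sg_m=Ig_m$ held on $D'_m$, then $u/m\le u_{D,V}$ on $D\setminus\overline V$. However, for all sufficiently large $m$ there is $z\in D'_m$ with $Sg_m(z)\ne Ig_m(z)$; so the non-compact version of Edwards' theorem fails for $X=D'_m$. 4. Consequently, the non-compact version of Edwards' theorem does not hold for all bounded open subsets $X$ of $\mathbb C^n$. -/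

import Mathlib

/-! ### Plurisubharmonic functions -/

/-- The mean over the circle `θ ↦ z + e^{iθ} w` of an extended real function, that is
`(1 / 2π) (∫₀^{2π} u⁺ dθ - ∫₀^{2π} u⁻ dθ)`. The first integral is finite whenever `u` is upper
semicontinuous with values in `[-∞, ∞)` along the circle, so no `∞ - ∞` arises there. -/
noncomputable def circleMean {n : ℕ} (u : EuclideanSpace ℂ (Fin n) → EReal)
    (z w : EuclideanSpace ℂ (Fin n)) : EReal :=
  (((∫⁻ θ in Set.Ioc (0 : ℝ) (2 * Real.pi),
        (u (z + Complex.exp (θ * Complex.I) • w)).toENNReal : ENNReal) : EReal)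
    - ((∫⁻ θ in Set.Ioc (0 : ℝ) (2 * Real.pi),
        (-(u (z + Complex.exp (θ * Complex.I) • w))).toENNReal : ENNReal) : EReal))
    / ((2 * Real.pi : ℝ) : EReal)

/-- `u` is plurisubharmonic on the domain (connected open set) `D ⊆ ℂⁿ`: it has values in
`[-∞, ∞)`, is not identically `-∞`, is upper semicontinuous, and satisfies the sub-mean value
inequality on every closed affine complex disc contained in `D`. Only the values on `D` matter. -/
structure IsPSH {n : ℕ} (D : Set (EuclideanSpace ℂ (Fin n)))
    (u : EuclideanSpace ℂ (Fin n) → EReal) : Prop where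
  lt_top : ∀ z ∈ D, u z < ⊤
  exists_ne_bot : ∃ z ∈ D, u z ≠ ⊥
  usc : UpperSemicontinuousOn u D
  submean : ∀ z w : EuclideanSpace ℂ (Fin n),
    (∀ ζ : ℂ, ‖ζ‖ ≤ 1 → z + ζ • w ∈ D) → u z ≤ circleMean u z w

/-- The function `u_{D,V}(z) = sup {v(z) : v ∈ PSH(D), v ≤ -χ_V on D}`. -/
noncomputable def relExtremal {n : ℕ} (D V : Set (EuclideanSpace ℂ (Fin n)))
    (z : EuclideanSpace ℂ (Fin n)) : EReal :=
  sSup {t : EReal | ∃ v : EuclideanSpace ℂ (Fin n) → EReal, IsPSH D v ∧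
    (∀ x ∈ D, v x ≤ ((-(V.indicator 1 x) : ℝ) : EReal)) ∧ t = v z}

/-! ### Jensen measures and the two sides of Edwards' duality -/

/-- `F` is a convex cone of continuous real functions on `X` that contains the constants. -/
structure IsConeWithConstants {X : Type*} [TopologicalSpace X] (F : Set (X → ℝ)) : Prop where
  continuous : ∀ f ∈ F, Continuous f
  add_mem : ∀ f ∈ F, ∀ g ∈ F, f + g ∈ F
  smul_mem : ∀ c : ℝ, 0 ≤ c → ∀ f ∈ F, c • f ∈ F
  const_mem : ∀ c : ℝ, (fun _ => c) ∈ F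

/-- The Jensen measures at `z` for `F`: Borel probability measures `μ` on `X`, with compact support
in `X`, such that `f z ≤ ∫ f dμ` for all `f ∈ F`. -/
def jensenMeasures {X : Type*} [TopologicalSpace X] [MeasurableSpace X] (F : Set (X → ℝ)) (z : X) :
    Set (MeasureTheory.Measure X) :=
  {μ | MeasureTheory.IsProbabilityMeasure μ ∧ (∃ K : Set X, IsCompact K ∧ μ Kᶜ = 0) ∧
    ∀ f ∈ F, f z ≤ ∫ x, f x ∂μ}

/-- `Sg(z) = sup {f(z) : f ∈ F, f ≤ g on X}`, in `[-∞, ∞]`. -/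
noncomputable def edwardsSup {X : Type*} (F : Set (X → ℝ)) (g : X → ℝ) (z : X) : EReal :=
  sSup {t : EReal | ∃ f ∈ F, (∀ x, f x ≤ g x) ∧ t = ((f z : ℝ) : EReal)}

/-- `Ig(z) = inf {∫ g dμ : μ a Jensen measure at z for F}`, in `[-∞, ∞]`. -/
noncomputable def edwardsInf {X : Type*} [TopologicalSpace X] [MeasurableSpace X]
    (F : Set (X → ℝ)) (g : X → ℝ) (z : X) : EReal :=
  sInf {t : EReal | ∃ μ ∈ jensenMeasures F z, t = ((∫ x, g x ∂μ : ℝ) : EReal)}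

/-- The assertion of the non-compact version of Edwards' theorem for the space `X`: for every convex
cone `F ⊆ C(X)` containing the constants and every `g ∈ C(X)`, either `Sg ≡ -∞` or `Sg = Ig`. -/
def NoncompactEdwards (X : Type*) [TopologicalSpace X] [MeasurableSpace X] : Prop :=
  ∀ F : Set (X → ℝ), IsConeWithConstants F → ∀ g : X → ℝ, Continuous g →
    (∀ z, edwardsSup F g z = ⊥) ∨ (∀ z, edwardsSup F g z = edwardsInf F g z)

/-! ### The objects of the counterexample -/

/-- `U_m = {u / m < -1} ∩ V`. -/
def sublevelSet {n : ℕ} (V : Set (EuclideanSpace ℂ (Fin n)))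
    (u : EuclideanSpace ℂ (Fin n) → EReal) (m : ℝ) : Set (EuclideanSpace ℂ (Fin n)) :=
  {z | u z / (m : EReal) < -1} ∩ V

/-- `D ∖ ∂U_m`. -/
def slitDomain {n : ℕ} (D V : Set (EuclideanSpace ℂ (Fin n)))
    (u : EuclideanSpace ℂ (Fin n) → EReal) (m : ℝ) : Set (EuclideanSpace ℂ (Fin n)) :=
  D \ frontier (sublevelSet V u m)

/-- The restrictions to `D'` of the functions in `PSH(D) ∩ C(closure D)`. -/
def pshContCone {n : ℕ} (D D' : Set (EuclideanSpace ℂ (Fin n))) : Set (D' → ℝ) :=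
  {f | ∃ v : EuclideanSpace ℂ (Fin n) → ℝ, ContinuousOn v (closure D) ∧
    IsPSH D (fun z => (v z : EReal)) ∧ ∀ z : D', f z = v z}

/-- The restriction to `D'` of `-χ_U`. -/
noncomputable def negChar {n : ℕ} (D' U : Set (EuclideanSpace ℂ (Fin n))) : D' → ℝ :=
  fun z => -(U.indicator 1 (z : EuclideanSpace ℂ (Fin n)))

/-! The two sides of the duality see different sets. A competitor for `Sg_m` is continuous on
`closure D`, so being at most `-1` on `U_m`, which contains the poles of `u` in `V` and is therefore
dense in `V`, it is at most `-1` on all of `closure V`. Hence `Sg_m ≤ u_{D,V}`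
(`edwardsSup_le_relExtremal`).

A Jensen measure, however, has compact support in `D'_m`, where `U_m` is clopen, so its support
meets `U_m` in a compact set. The function `max (u/m) (-1)` can be regularized to a continuous
plurisubharmonic function that still equals `-1` on that compact set and is no smaller at the given
point (`IsSupermean.exists_continuous_psh`). Hence `u/m ≤ Ig_m` (`div_le_edwardsInf`).

At a point off `closure V` where `u ≠ -∞`, `u/m` tends to `0` while `u_{D,V}` is negative and
independent of `m`; equality must fail for large `m`. The existence of such a point and the
negativity of `u_{D,V}` both follow from a Harnack-type estimate, `IsSupermean.exists_propagation`.
The function `u` itself is a weighted sum of logarithms with dense poles.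

Nonpositive functions `u` are handled through `-u`, valued in `[0, ∞]`, where Tonelli needs no
integrability. -/

/-! ### Super-mean functions and propagation of lower bounds -/

open MeasureTheory in
/-- The super-mean value inequality, on circles, for a function with values in `[0, ∞]`. -/
def IsSupermean {n : ℕ} (D : Set (EuclideanSpace ℂ (Fin n)))
    (φ : EuclideanSpace ℂ (Fin n) → ENNReal) : Prop :=
  ∀ z w : EuclideanSpace ℂ (Fin n), (∀ ζ : ℂ, ‖ζ‖ ≤ 1 → z + ζ • w ∈ D) →
    ∫⁻ θ in Set.Ioc (0 : ℝ) (2 * Real.pi), φ (z + Complex.exp (θ * Complex.I) • w) ≤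
      ENNReal.ofReal (2 * Real.pi) * φ z

-- For nonpositive `u` the positive part contributes nothing to the mean, so the inequality becomes
-- one between `[0, ∞]`-valued quantities.
open MeasureTheory in
theorem le_circleMean_iff {n : ℕ} {u : EuclideanSpace ℂ (Fin n) → EReal}
    {z w : EuclideanSpace ℂ (Fin n)} (hz : u z ≤ 0)
    (hu : ∀ θ : ℝ, u (z + Complex.exp (θ * Complex.I) • w) ≤ 0) :
    u z ≤ circleMean u z w ↔
      ∫⁻ θ in Set.Ioc (0 : ℝ) (2 * Real.pi),
        (-(u (z + Complex.exp (θ * Complex.I) • w))).toENNReal ≤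
      ENNReal.ofReal (2 * Real.pi) * (-(u z)).toENNReal := by
  have h0 : (∫⁻ θ in Set.Ioc (0 : ℝ) (2 * Real.pi),
        (u (z + Complex.exp (θ * Complex.I) • w)).toENNReal) = 0 := by
    simp [EReal.toENNReal_of_nonpos (hu _)]
  have hpi : (0 : EReal) < ((2 * Real.pi : ℝ) : EReal) := by
    exact_mod_cast Real.two_pi_pos
  unfold circleMean
  rw [h0, EReal.le_div_iff_mul_le hpi (EReal.coe_ne_top _), EReal.coe_ennreal_zero, zero_sub,
    EReal.le_neg, ← EReal.neg_mul, ← EReal.coe_ennreal_le_coe_ennreal_iff, EReal.coe_ennreal_mul,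
    EReal.coe_toENNReal (by simpa using EReal.neg_le_neg_iff.2 hz), mul_comm (-(u z)),
    EReal.coe_ennreal_ofReal, max_eq_left Real.two_pi_pos.le]

theorem circle_mem {n : ℕ} {D : Set (EuclideanSpace ℂ (Fin n))} {z w : EuclideanSpace ℂ (Fin n)}
    (h : ∀ ζ : ℂ, ‖ζ‖ ≤ 1 → z + ζ • w ∈ D) (θ : ℝ) :
    z + Complex.exp (θ * Complex.I) • w ∈ D :=
  h _ (Complex.norm_exp_ofReal_mul_I θ).le

theorem center_mem {n : ℕ} {D : Set (EuclideanSpace ℂ (Fin n))} {z w : EuclideanSpace ℂ (Fin n)}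
    (h : ∀ ζ : ℂ, ‖ζ‖ ≤ 1 → z + ζ • w ∈ D) : z ∈ D := by
  simpa using h 0 (by simp)

theorem IsPSH.isSupermean {n : ℕ} {D : Set (EuclideanSpace ℂ (Fin n))}
    {u : EuclideanSpace ℂ (Fin n) → EReal} (hu : IsPSH D u) (h0 : ∀ z ∈ D, u z ≤ 0) :
    IsSupermean D (fun z => (-(u z)).toENNReal) := fun z w h =>
  (le_circleMean_iff (h0 _ (center_mem h)) fun θ => h0 _ (circle_mem h θ)).1 (hu.submean z w h)

open MeasureTheory in
/-- Lower bounds for super-mean functions propagate through a connected open set. -/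
theorem IsSupermean.exists_propagation {n : ℕ} {D V : Set (EuclideanSpace ℂ (Fin n))}
    (hDo : IsOpen D) (hDc : IsPreconnected D) (hVo : IsOpen V) (hVD : V ⊆ D) (hV : V.Nonempty)
    {z : EuclideanSpace ℂ (Fin n)} (hz : z ∈ D) :
    ∃ δ : ENNReal, δ ≠ 0 ∧ ∀ φ, IsSupermean D φ → ∀ t : ENNReal, (∀ x ∈ V, t ≤ φ x) →
      t * δ ≤ φ z := by
  -- The points around which one constant serves all `φ` and `t` on a whole ball. This set is open
  -- and relatively closed in `D`, and meets `V`.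
  let P : Set (EuclideanSpace ℂ (Fin n)) := {x | ∃ s : ℝ, 0 < s ∧ ∃ δ : ENNReal, δ ≠ 0 ∧
    ∀ φ, IsSupermean D φ → ∀ t : ENNReal, (∀ x ∈ V, t ≤ φ x) →
      ∀ y ∈ Metric.ball x s, t * δ ≤ φ y}
  suffices h : D ⊆ P by
    obtain ⟨s, hs, δ, hδ, H⟩ := h hz
    exact ⟨δ, hδ, fun φ hφ t ht => H φ hφ t ht z (Metric.mem_ball_self hs)⟩
  have hPo : IsOpen P := by
    rw [Metric.isOpen_iff]
    rintro x ⟨s, hs, δ, hδ, H⟩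
    refine ⟨s, hs, fun y hy => ⟨s - dist y x, sub_pos.2 hy, δ, hδ, fun φ hφ t ht y' hy' =>
      H φ hφ t ht y' ?_⟩⟩
    exact Metric.ball_subset_ball' (by simp) hy'
  refine hDc.subset_of_closure_inter_subset hPo ?_ ?_
  · obtain ⟨x, hx⟩ := hV
    obtain ⟨s, hs, hsV⟩ := Metric.isOpen_iff.1 hVo x hx
    exact ⟨x, hVD hx, s, hs, 1, one_ne_zero, fun φ _ t ht y hy => by
      simpa using ht y (hsV hy)⟩
  · rintro y ⟨hyc, hyD⟩
    obtain ⟨ε, hε, hεD⟩ := Metric.isOpen_iff.1 hDo y hyD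
    obtain ⟨x, ⟨s, hs, δ, hδ, H⟩, hxy⟩ := Metric.mem_closure_iff.1 hyc (ε / 4) (by positivity)
    -- The circle about `y'` through `x` has radius below `ε / 2`, so for angles in `(0, η]` it
    -- stays within `(s / ε) * (ε / 2) < s` of `x`. That arc alone gives the lower bound, at the
    -- cost of a factor `η / 2π`.
    set η : ℝ := min (s / ε) 1 with hη
    have hη0 : 0 < η := by positivity
    have hpi : ENNReal.ofReal (2 * Real.pi) ≠ 0 := by
      simpa using Real.pi_pos
    refine ⟨ε / 4, by positivity, δ * (ENNReal.ofReal η / ENNReal.ofReal (2 * Real.pi)), ?_, ?_⟩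
    · refine mul_ne_zero hδ (ENNReal.div_pos ?_ ENNReal.ofReal_ne_top).ne'
      simpa using hη0
    · intro φ hφ t ht y' hy'
      rw [Metric.mem_ball] at hy'
      have hw : ‖x - y'‖ < ε / 2 := by
        rw [← dist_eq_norm]
        have := dist_triangle x y y'
        rw [dist_comm x y, dist_comm y y'] at this
        linarith
      have hdisc : ∀ ζ : ℂ, ‖ζ‖ ≤ 1 → y' + ζ • (x - y') ∈ D := by
        intro ζ hζ
        apply hεD
        rw [Metric.mem_ball]
        have h1 : dist (y' + ζ • (x - y')) y' ≤ ‖x - y'‖ := by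
          rw [dist_eq_norm, add_sub_cancel_left, norm_smul]
          exact mul_le_of_le_one_left (norm_nonneg _) hζ
        linarith [dist_triangle (y' + ζ • (x - y')) y' y]
      have hmean := hφ y' (x - y') hdisc
      have hlow : t * δ * ENNReal.ofReal η ≤ ∫⁻ θ in Set.Ioc (0 : ℝ) (2 * Real.pi),
          φ (y' + Complex.exp (θ * Complex.I) • (x - y')) := by
        have hsub : Set.Ioc (0 : ℝ) η ⊆ Set.Ioc (0 : ℝ) (2 * Real.pi) :=
          Set.Ioc_subset_Ioc_right ((min_le_right _ _).trans (by linarith [Real.pi_gt_three]))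
        calc t * δ * ENNReal.ofReal η = ∫⁻ _ in Set.Ioc (0 : ℝ) η, t * δ := by simp
          _ ≤ ∫⁻ θ in Set.Ioc (0 : ℝ) η,
              φ (y' + Complex.exp (θ * Complex.I) • (x - y')) := by
            refine setLIntegral_mono' measurableSet_Ioc fun θ hθ => H φ hφ t ht _ ?_
            rw [Metric.mem_ball, dist_eq_norm]
            have e : y' + Complex.exp (θ * Complex.I) • (x - y') - x
                = (Complex.exp (Complex.I * θ) - 1) • (x - y') := by
              rw [mul_comm Complex.I, sub_smul, one_smul]; abel
            rw [e, norm_smul]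
            have h2 := Real.norm_exp_I_mul_ofReal_sub_one_le (x := θ)
            rw [Real.norm_of_nonneg hθ.1.le] at h2
            have h3 : θ ≤ s / ε := hθ.2.trans (min_le_left _ _)
            calc _ ≤ (s / ε) * (ε / 2) :=
                  mul_le_mul (h2.trans h3) hw.le (norm_nonneg _) (by positivity)
              _ = s / 2 := by field_simp
              _ < s := by linarith
          _ ≤ _ := lintegral_mono_set hsub
      calc t * (δ * (ENNReal.ofReal η / ENNReal.ofReal (2 * Real.pi)))
          = t * δ * ENNReal.ofReal η / ENNReal.ofReal (2 * Real.pi) := by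
            rw [← mul_assoc, mul_div_assoc]
        _ ≤ φ y' := by
            rw [ENNReal.div_le_iff hpi ENNReal.ofReal_ne_top, mul_comm (φ y')]
            exact hlow.trans hmean

/-- A nonpositive plurisubharmonic function is not identically `-∞` on any nonempty open set. -/
theorem IsPSH.exists_ne_bot_of_isOpen {n : ℕ} {D O : Set (EuclideanSpace ℂ (Fin n))}
    {u : EuclideanSpace ℂ (Fin n) → EReal} (hu : IsPSH D u) (h0 : ∀ z ∈ D, u z ≤ 0)
    (hDo : IsOpen D) (hDc : IsPreconnected D) (hO : IsOpen O) (hOD : O ⊆ D) (hne : O.Nonempty) :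
    ∃ z ∈ O, u z ≠ ⊥ := by
  by_contra! H
  obtain ⟨z, hz, hzb⟩ := hu.exists_ne_bot
  obtain ⟨δ, hδ, h⟩ := IsSupermean.exists_propagation hDo hDc hO hOD hne hz
  -- The value `t = ∞` is allowed: as `δ ≠ 0`, an infinite bound propagates undiminished.
  have := h _ (hu.isSupermean h0) ⊤ (fun x hx => by simp [H x hx])
  rw [ENNReal.top_mul hδ, top_le_iff, EReal.toENNReal_eq_top_iff] at this
  exact hzb (by simpa using this)

/-- The propagation constant `δ` does not depend on the competitor, so the supremum is at most `-δ`.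
-/
theorem relExtremal_neg {n : ℕ} {D V : Set (EuclideanSpace ℂ (Fin n))}
    (hDo : IsOpen D) (hDc : IsPreconnected D) (hVo : IsOpen V) (hVD : V ⊆ D) (hV : V.Nonempty)
    {z : EuclideanSpace ℂ (Fin n)} (hz : z ∈ D) : relExtremal D V z < 0 := by
  obtain ⟨δ, hδ, h⟩ := IsSupermean.exists_propagation hDo hDc hVo hVD hV hz
  have hneg : -(δ : EReal) < 0 := by
    rw [EReal.neg_lt_comm, neg_zero]
    exact_mod_cast pos_iff_ne_zero.2 hδ
  refine lt_of_le_of_lt (sSup_le ?_) hneg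
  rintro t ⟨v, hv, hvle, rfl⟩
  have hv0 : ∀ x ∈ D, v x ≤ 0 := fun x hx => (hvle x hx).trans (by
    rw [← EReal.coe_zero, EReal.coe_le_coe_iff, neg_nonpos]
    exact Set.indicator_nonneg (fun _ _ => zero_le_one) _)
  have := h _ (hv.isSupermean hv0) 1 (fun x hx => by
    have h1 := hvle x (hVD hx)
    rw [Set.indicator_of_mem hx, Pi.one_apply] at h1
    have h2 : ((1 : ENNReal) : EReal) ≤ -(v x) := by
      rw [EReal.le_neg]; simpa using h1
    have h3 := EReal.toENNReal_le_toENNReal h2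
    rwa [EReal.toENNReal_coe] at h3)
  rw [one_mul, ← EReal.coe_ennreal_le_coe_ennreal_iff, EReal.coe_toENNReal
    (by simpa using EReal.neg_le_neg_iff.2 (hv0 z hz)), EReal.le_neg] at this
  exact this

/-! ### A nonpositive plurisubharmonic function with dense poles -/

-- After factoring out `w`, the unit circle average of `log |ζ - a|` is `log⁺ |a|`, which dominates
-- `log |a|`.
open MeasureTheory in
theorem log_norm_le_circle_integral (c w : ℂ) (hw : w ≠ 0) (hc : c ≠ 0) :
    IntegrableOn (fun θ : ℝ => Real.log ‖c + Complex.exp (θ * Complex.I) * w‖)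
      (Set.Ioc 0 (2 * Real.pi)) ∧
    2 * Real.pi * Real.log ‖c‖ ≤
      ∫ θ in Set.Ioc (0 : ℝ) (2 * Real.pi), Real.log ‖c + Complex.exp (θ * Complex.I) * w‖ := by
  have hpi := Real.two_pi_pos
  have hnull : ∀ᵐ θ : ℝ ∂(volume.restrict (Set.Ioc (0 : ℝ) (2 * Real.pi))),
      Real.log ‖c + Complex.exp (θ * Complex.I) * w‖ =
        Real.log ‖w‖ + Real.log ‖circleMap 0 1 θ - (-c / w)‖ := by
    -- The logarithm of the product splits except at the zeros, where `Real.log 0 = 0` is a junk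
    -- value; these angles form a countable set.
    have hfin : (circleMap 0 1 ⁻¹' {-c / w}).Countable :=
      Set.Countable.preimage_circleMap (Set.countable_singleton _) 0 one_ne_zero
    have h1 : ∀ᵐ θ : ℝ, θ ∉ circleMap 0 1 ⁻¹' {-c / w} := hfin.ae_notMem volume
    filter_upwards [ae_restrict_of_ae h1] with θ hθ
    have h2 : circleMap 0 1 θ - (-c / w) ≠ 0 := by
      rw [sub_ne_zero]; simpa using hθ
    rw [← Real.log_mul (by simpa using hw) (by simpa using h2), ← norm_mul]
    congr 2
    simp only [circleMap, zero_add, Complex.ofReal_one, one_mul]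
    field_simp
    ring
  have hci : IntegrableOn (fun θ : ℝ => Real.log ‖circleMap 0 1 θ - (-c / w)‖)
      (Set.Ioc 0 (2 * Real.pi)) := by
    have := circleIntegrable_log_norm_sub_const (a := -c / w) (c := 0) 1
    exact (intervalIntegrable_iff_integrableOn_Ioc_of_le hpi.le).1 this
  have hsum : IntegrableOn (fun θ : ℝ => Real.log ‖w‖ + Real.log ‖circleMap 0 1 θ - (-c / w)‖)
      (Set.Ioc 0 (2 * Real.pi)) := (integrable_const _).add hci
  refine ⟨hsum.congr (hnull.mono fun _ h => h.symm), ?_⟩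
  rw [integral_congr_ae hnull, integral_add (integrable_const _) hci]
  have havg := circleAverage_log_norm_sub_const_eq_posLog (a := -c / w)
  rw [Real.circleAverage, intervalIntegral.integral_of_le hpi.le, smul_eq_mul,
    inv_mul_eq_iff_eq_mul₀ hpi.ne'] at havg
  rw [havg]
  have h3 : Real.log ‖-c / w‖ ≤ Real.posLog ‖-c / w‖ := le_max_right _ _
  rw [norm_div, norm_neg, Real.log_div (by simpa using hc) (by simpa using hw)] at h3
  have h4 : ∫ _ in Set.Ioc (0 : ℝ) (2 * Real.pi), Real.log ‖w‖ = 2 * Real.pi * Real.log ‖w‖ := by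
    simp [hpi.le]
  rw [h4, norm_div, norm_neg]
  nlinarith

/-- The nonnegative function `-log (‖c - q‖ / C)`, with the value `∞` at `q`. -/
noncomputable def negLog (q : ℂ) (C : ℝ) (c : ℂ) : ENNReal :=
  (-(ENNReal.log (ENNReal.ofReal (‖c - q‖ / C)))).toENNReal

theorem negLog_self (q : ℂ) (C : ℝ) : negLog q C q = ⊤ := by simp [negLog]

theorem negLog_of_ne {q c : ℂ} {C : ℝ} (hC : 0 < C) (h : c ≠ q) :
    negLog q C c = ENNReal.ofReal (Real.log C - Real.log ‖c - q‖) := by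
  have h1 : 0 < ‖c - q‖ := norm_pos_iff.2 (sub_ne_zero.2 h)
  rw [negLog, ENNReal.log_ofReal_of_pos (by positivity), Real.log_div h1.ne' hC.ne',
    ← EReal.coe_neg, neg_sub, EReal.toENNReal_of_ne_top (EReal.coe_ne_top _), EReal.toReal_coe]

theorem continuous_negLog (q : ℂ) (C : ℝ) : Continuous (negLog q C) := by
  unfold negLog
  refine EReal.continuous_toENNReal.comp (continuous_neg.comp
    (ENNReal.continuous_log.comp (ENNReal.continuous_ofReal.comp ?_)))
  fun_prop

-- The bound by `C` on the disc keeps `log C - log |c - q|` nonnegative, so `ENNReal.ofReal`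
-- truncates nothing and the real inequality carries over.
open MeasureTheory in
theorem negLog_supermean (q : ℂ) {C : ℝ} (hC : 0 < C) (c w : ℂ)
    (hcw : ∀ ζ : ℂ, ‖ζ‖ ≤ 1 → ‖c + ζ * w - q‖ ≤ C) :
    ∫⁻ θ in Set.Ioc (0 : ℝ) (2 * Real.pi), negLog q C (c + Complex.exp (θ * Complex.I) * w) ≤
      ENNReal.ofReal (2 * Real.pi) * negLog q C c := by
  have hpi : ENNReal.ofReal (2 * Real.pi) ≠ 0 := by simpa using Real.pi_pos
  rcases eq_or_ne w 0 with rfl | hw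
  · simp [mul_comm]
  rcases eq_or_ne c q with rfl | hc
  · rw [negLog_self, ENNReal.mul_top hpi]; exact le_top
  obtain ⟨hint, hle⟩ := log_norm_le_circle_integral (c - q) w hw (sub_ne_zero.2 hc)
  have hne : ∀ᵐ θ : ℝ ∂(volume.restrict (Set.Ioc (0 : ℝ) (2 * Real.pi))),
      c - q + Complex.exp (θ * Complex.I) * w ≠ 0 := by
    have hfin : (circleMap 0 1 ⁻¹' {-(c - q) / w}).Countable :=
      Set.Countable.preimage_circleMap (Set.countable_singleton _) 0 one_ne_zero
    have h1 : ∀ᵐ θ : ℝ, θ ∉ circleMap 0 1 ⁻¹' {-(c - q) / w} := hfin.ae_notMem volume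
    filter_upwards [ae_restrict_of_ae h1] with θ hθ h
    apply hθ
    simp only [circleMap, zero_add, Complex.ofReal_one, one_mul, Set.mem_preimage,
      Set.mem_singleton_iff]
    rw [eq_div_iff hw, eq_neg_iff_add_eq_zero, add_comm, h]
  have hnull : ∀ᵐ θ : ℝ ∂(volume.restrict (Set.Ioc (0 : ℝ) (2 * Real.pi))),
      negLog q C (c + Complex.exp (θ * Complex.I) * w) = ENNReal.ofReal
        (Real.log C - Real.log ‖c - q + Complex.exp (θ * Complex.I) * w‖) := by
    filter_upwards [hne] with θ hθ
    rw [← add_sub_right_comm] at hθ ⊢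
    exact negLog_of_ne hC (sub_ne_zero.1 hθ)
  have hint2 : IntegrableOn (fun θ : ℝ =>
      Real.log C - Real.log ‖c - q + Complex.exp (θ * Complex.I) * w‖)
      (Set.Ioc 0 (2 * Real.pi)) := (integrable_const _).sub hint
  have hnn : ∀ᵐ θ : ℝ ∂(volume.restrict (Set.Ioc (0 : ℝ) (2 * Real.pi))),
      0 ≤ Real.log C - Real.log ‖c - q + Complex.exp (θ * Complex.I) * w‖ := by
    filter_upwards [hne] with θ hθ
    have h1 := hcw _ (Complex.norm_exp_ofReal_mul_I θ).le
    rw [add_sub_right_comm] at h1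
    exact sub_nonneg.2 (Real.log_le_log (norm_pos_iff.2 hθ) h1)
  rw [lintegral_congr_ae hnull, ← ofReal_integral_eq_lintegral_ofReal hint2 hnn,
    negLog_of_ne hC hc, ← ENNReal.ofReal_mul Real.two_pi_pos.le]
  apply ENNReal.ofReal_le_ofReal
  rw [integral_sub (integrable_const _) hint]
  have h4 : ∫ _ in Set.Ioc (0 : ℝ) (2 * Real.pi), Real.log C = 2 * Real.pi * Real.log C := by
    simp [Real.pi_pos.le]
  rw [h4]
  nlinarith

theorem exists_dense_range_ne (a : ℂ) : ∃ q : ℕ → ℂ, DenseRange q ∧ ∀ j, q j ≠ a := by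
  have hd : Dense (Set.range (TopologicalSpace.denseSeq ℂ) \ {a}) :=
    (TopologicalSpace.denseRange_denseSeq ℂ).sdiff_singleton a
  obtain ⟨q, hq⟩ := ((Set.countable_range (TopologicalSpace.denseSeq ℂ)).mono
    Set.sdiff_subset).exists_eq_range hd.nonempty
  refine ⟨q, by rwa [hq] at hd, fun j hj => ?_⟩
  have : q j ∈ Set.range (TopologicalSpace.denseSeq ℂ) \ {a} := hq ▸ Set.mem_range_self j
  exact this.2 hj

-- The function is `-∑ δ_j negLog (q_j) (z_i)`, depending on one coordinate only, with poles on the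
-- hyperplanes `z_i = q_j`. The `q_j` avoid `a_i`, so the weights can be chosen to make the sum
-- finite at `a`.
open MeasureTheory in
theorem exists_psh_dense_bot {n : ℕ} (i : Fin n) {D V : Set (EuclideanSpace ℂ (Fin n))}
    (hD : Bornology.IsBounded D) (hne : D.Nonempty) (hV : IsOpen V) :
    ∃ u : EuclideanSpace ℂ (Fin n) → EReal,
      IsPSH D u ∧ (∀ z ∈ D, u z ≤ 0) ∧ V ⊆ closure {z ∈ V | u z = ⊥} := by
  obtain ⟨a, ha⟩ := hne
  obtain ⟨q, hqd, hqa⟩ := exists_dense_range_ne (a i)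
  obtain ⟨R, hR0, hR⟩ := hD.exists_pos_norm_le
  have hC : ∀ j, 0 < R + ‖q j‖ := fun j => by positivity
  obtain ⟨δ, hδ0, hδ⟩ := ENNReal.exists_pos_tsum_mul_lt_of_countable one_ne_zero
    (fun j => negLog (q j) (R + ‖q j‖) (a i)) (fun j => by
      rw [negLog_of_ne (hC j) (hqa j).symm]; exact ENNReal.ofReal_ne_top)
  let φ : EuclideanSpace ℂ (Fin n) → ENNReal := fun z =>
    ∑' j, negLog (q j) (R + ‖q j‖) (z i) * (δ j : ENNReal)
  have hci : Continuous fun z : EuclideanSpace ℂ (Fin n) => z i := by fun_prop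
  have hterm : ∀ j, Continuous fun z : EuclideanSpace ℂ (Fin n) =>
      negLog (q j) (R + ‖q j‖) (z i) * (δ j : ENNReal) := fun j =>
    ENNReal.continuous_mul_const ENNReal.coe_ne_top |>.comp ((continuous_negLog _ _).comp hci)
  have hlsc : LowerSemicontinuous φ :=
    lowerSemicontinuous_tsum fun j => (hterm j).lowerSemicontinuous
  have hu0 : ∀ z, -(φ z : EReal) ≤ 0 := fun z => by
    rw [EReal.neg_le, neg_zero]; exact EReal.coe_ennreal_nonneg _
  refine ⟨fun z => -(φ z : EReal), ⟨fun z _ => (hu0 z).trans_lt EReal.zero_lt_top,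
    ⟨a, ha, ?_⟩, ?_, ?_⟩, fun z _ => hu0 z, ?_⟩
  · simpa using (hδ.trans ENNReal.one_lt_top).ne
  · refine UpperSemicontinuous.upperSemicontinuousOn ?_ D
    have h1 : LowerSemicontinuous fun z => (φ z : EReal) :=
      continuous_coe_ennreal_ereal.comp_lowerSemicontinuous hlsc
        fun _ _ h => EReal.coe_ennreal_le_coe_ennreal_iff.2 h
    exact continuous_neg.comp_lowerSemicontinuous_antitone h1
      fun _ _ h => EReal.neg_le_neg_iff.2 h
  · intro z w h
    refine (le_circleMean_iff (u := fun z => -(φ z : EReal)) (hu0 z) fun θ => hu0 _).2 ?_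
    simp only [neg_neg, EReal.toENNReal_coe]
    have hcirc : Continuous fun θ : ℝ => z + Complex.exp (θ * Complex.I) • w := by fun_prop
    have hmeas : ∀ j, Measurable fun θ : ℝ => negLog (q j) (R + ‖q j‖)
        ((z + Complex.exp (θ * Complex.I) • w) i) * (δ j : ENNReal) :=
      fun j => ((hterm j).comp hcirc).measurable
    simp only [φ]
    rw [lintegral_tsum fun j => (hmeas j).aemeasurable, ← ENNReal.tsum_mul_left]
    refine ENNReal.tsum_le_tsum fun j => ?_
    rw [lintegral_mul_const' _ _ ENNReal.coe_ne_top, ← mul_assoc]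
    gcongr
    refine negLog_supermean (q j) (hC j) (z i) (w i) fun ζ hζ => ?_
    have h1 := hR _ (h ζ hζ)
    have h2 : ‖(z + ζ • w) i‖ ≤ ‖z + ζ • w‖ := PiLp.norm_apply_le _ i
    refine (norm_sub_le _ _).trans ?_
    have h3 : (z + ζ • w) i = z i + ζ * w i := by simp
    rw [h3] at h2
    linarith
  · intro z hz
    rw [Metric.mem_closure_iff]
    intro ε hε
    obtain ⟨s, hs, hsV⟩ := Metric.isOpen_iff.1 hV z hz
    -- Moving only the `i`-th coordinate of `z` to a nearby `q j` reaches a pole.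
    obtain ⟨j, hj⟩ := hqd.exists_dist_lt (z i) (lt_min hε hs)
    have hdist : dist z (z + EuclideanSpace.single i (q j - z i)) < min ε s := by
      rw [dist_eq_norm, sub_add_cancel_left, norm_neg, PiLp.norm_single,
        ← dist_eq_norm, dist_comm]
      exact hj
    refine ⟨z + EuclideanSpace.single i (q j - z i), ⟨hsV ?_, ?_⟩, hdist.trans_le (min_le_left _ _)⟩
    · rw [Metric.mem_ball, dist_comm]; exact hdist.trans_le (min_le_right _ _)
    · have : φ (z + EuclideanSpace.single i (q j - z i)) = ⊤ := by
        refine ENNReal.tsum_eq_top_of_eq_top ⟨j, ?_⟩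
        have h3 : (z + EuclideanSpace.single i (q j - z i)) i = q j := by simp
        rw [h3, negLog_self, ENNReal.top_mul (by simpa using (hδ0 j).ne')]
      simp [this]

/-! ### Continuous regularization -/

open MeasureTheory in
/-- There are circle-invariant probability measures with arbitrarily small support, convolution
with which turns bounded functions into continuous ones. -/
theorem exists_circular_kernel (n : ℕ) {ε : ℝ} (hε : 0 < ε) :
    ∃ ν : Measure (EuclideanSpace ℂ (Fin n)), IsProbabilityMeasure ν ∧
      (∀ᵐ y ∂ν, ‖y‖ < ε) ∧
      (∀ θ : ℝ, ν.map (fun y => Complex.exp (θ * Complex.I) • y) = ν) ∧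
      ∀ φ : EuclideanSpace ℂ (Fin n) → ENNReal, Measurable φ → (∀ x, φ x ≤ 1) →
        Continuous fun x => (∫⁻ y, φ (x - y) ∂ν).toReal := by
  -- A radial density is invariant under the rotations `e^{iθ}`; its continuity and compact support
  -- make convolutions with bounded functions continuous.
  let k : EuclideanSpace ℂ (Fin n) → NNReal := fun y => Real.toNNReal (ε - ‖y‖)
  have hkc : Continuous k := by fun_prop
  have hks : ∀ y, ε ≤ ‖y‖ → k y = 0 := fun y hy => by simpa [k] using hy
  have hkcomp : HasCompactSupport k := by
    refine HasCompactSupport.of_support_subset_isCompact (isCompact_closedBall 0 ε) fun y hy => ?_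
    rw [mem_closedBall_zero_iff]
    by_contra! h
    exact hy (hks y h.le)
  have hkm : Measurable fun y => (k y : ENNReal) :=
    measurable_coe_nnreal_ennreal.comp hkc.measurable
  obtain ⟨ν₀, hν₀⟩ : ∃ ν₀ : Measure (EuclideanSpace ℂ (Fin n)),
    ν₀ = volume.withDensity fun y => (k y : ENNReal) := ⟨_, rfl⟩
  have huniv : ν₀ Set.univ = ∫⁻ y, (k y : ENNReal) := by
    rw [hν₀, withDensity_apply _ MeasurableSet.univ, Measure.restrict_univ]
  have hball : ν₀ Set.univ ≠ 0 := by
    rw [huniv, ← pos_iff_ne_zero, lintegral_pos_iff_support hkm]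
    refine lt_of_lt_of_le (Metric.measure_ball_pos volume (0 : EuclideanSpace ℂ (Fin n)) hε)
      (measure_mono fun y hy => ?_)
    rw [mem_ball_zero_iff] at hy
    simpa [k] using hy
  have hkcomp' : HasCompactSupport fun y => (k y : ℝ) :=
    hkcomp.comp_left (g := fun t : NNReal => (t : ℝ)) rfl
  have hkc' : Continuous fun y => (k y : ℝ) := NNReal.continuous_coe.comp hkc
  have hfin : ν₀ Set.univ ≠ ⊤ := by
    rw [huniv]
    have := (hkc'.integrable_of_hasCompactSupport (μ := volume) hkcomp').lintegral_lt_top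
    simpa only [ENNReal.ofReal_coe_nnreal] using this.ne
  refine ⟨(ν₀ Set.univ)⁻¹ • ν₀, ⟨?_⟩, ?_, ?_, ?_⟩
  · rw [Measure.smul_apply, smul_eq_mul, ENNReal.inv_mul_cancel hball hfin]
  · refine Measure.ae_smul_measure ?_ _
    rw [hν₀, ae_withDensity_iff hkm]
    refine .of_forall fun y hy => ?_
    by_contra! h
    exact hy (by simp [hks y h])
  · intro θ
    have hmap : ν₀.map (fun y => Complex.exp (θ * Complex.I) • y) = ν₀ := by
      have hnorm : ∀ y : EuclideanSpace ℂ (Fin n), ‖Complex.exp (θ * Complex.I) • y‖ = ‖y‖ :=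
        fun y => by rw [norm_smul, Complex.norm_exp_ofReal_mul_I, one_mul]
      let e : EuclideanSpace ℂ (Fin n) ≃ₗᵢ[ℝ] EuclideanSpace ℂ (Fin n) :=
        ⟨(LinearEquiv.smulOfNeZero ℂ (EuclideanSpace ℂ (Fin n)) (Complex.exp (θ * Complex.I))
          (Complex.exp_ne_zero _)).restrictScalars ℝ, hnorm⟩
      have he : MeasurePreserving (fun y : EuclideanSpace ℂ (Fin n) =>
          Complex.exp (θ * Complex.I) • y) volume volume := e.measurePreserving
      ext A hA
      rw [Measure.map_apply he.measurable hA, hν₀, withDensity_apply _ hA,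
        withDensity_apply _ (he.measurable hA), ← he.setLIntegral_comp_preimage hA hkm]
      simp only [k, hnorm]
    rw [Measure.map_smul, hmap]
  · intro φ hφ hφ1
    have hint : ∀ x, (∫⁻ y, φ (x - y) ∂((ν₀ Set.univ)⁻¹ • ν₀)).toReal =
        (ν₀ Set.univ)⁻¹.toReal * convolution (fun y => (k y : ℝ)) (fun y => (φ y).toReal)
          (ContinuousLinearMap.lsmul ℝ ℝ) volume x := by
      intro x
      have hm : Measurable fun y => φ (x - y) := hφ.comp (measurable_const.sub measurable_id)
      rw [lintegral_smul_measure, smul_eq_mul, ENNReal.toReal_mul, ← integral_toReal hm.aemeasurable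
        (.of_forall fun y => (hφ1 _).trans_lt ENNReal.one_lt_top)]
      rw [hν₀, integral_withDensity_eq_integral_smul hkc.measurable]
      rfl
    simp only [hint]
    refine continuous_const.mul (hkcomp'.continuous_convolution_left _ hkc' ?_)
    refine (memLp_top_of_bound (C := 1) hφ.ennreal_toReal.aestronglyMeasurable
        (.of_forall fun y => ?_)).locallyIntegrable le_top
    rw [Real.norm_of_nonneg ENNReal.toReal_nonneg]
    simpa using ENNReal.toReal_mono ENNReal.one_ne_top (hφ1 y)

open MeasureTheory in
theorem IsSupermean.convolution {n : ℕ} {D D₁ : Set (EuclideanSpace ℂ (Fin n))}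
    {φ : EuclideanSpace ℂ (Fin n) → ENNReal} (hφ : IsSupermean D φ) (hm : Measurable φ)
    {ν : Measure (EuclideanSpace ℂ (Fin n))} [SFinite ν] {ε : ℝ} (hν : ∀ᵐ y ∂ν, ‖y‖ < ε)
    (hD : ∀ x ∈ D₁, ∀ y, ‖y‖ < ε → x - y ∈ D) :
    IsSupermean D₁ fun x => ∫⁻ y, φ (x - y) ∂ν := by
  intro z w h
  have hmeas : Measurable (Function.uncurry fun (θ : ℝ) (y : EuclideanSpace ℂ (Fin n)) =>
      φ (z + Complex.exp (θ * Complex.I) • w - y)) :=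
    hm.comp (Continuous.measurable (by fun_prop))
  rw [lintegral_lintegral_swap hmeas.aemeasurable, ← lintegral_const_mul' _ _ ENNReal.ofReal_ne_top]
  refine lintegral_mono_ae (hν.mono fun y hy => ?_)
  simp only [add_sub_right_comm]
  exact hφ (z - y) w fun ζ hζ => by
    rw [← add_sub_right_comm]; exact hD _ (h ζ hζ) y hy

-- Rotation invariance of `ν` permits averaging over `θ` first, which turns the convolution at `x`
-- into an average of means over circles centred at `x`.
open MeasureTheory in
theorem IsSupermean.convolution_le {n : ℕ} {D : Set (EuclideanSpace ℂ (Fin n))}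
    {φ : EuclideanSpace ℂ (Fin n) → ENNReal} (hφ : IsSupermean D φ) (hm : Measurable φ)
    {ν : Measure (EuclideanSpace ℂ (Fin n))} [IsProbabilityMeasure ν] {ε : ℝ}
    (hν : ∀ᵐ y ∂ν, ‖y‖ < ε)
    (hrot : ∀ θ : ℝ, ν.map (fun y => Complex.exp (θ * Complex.I) • y) = ν)
    {x : EuclideanSpace ℂ (Fin n)} (hx : ∀ y, ‖y‖ < ε → x - y ∈ D) :
    ∫⁻ y, φ (x - y) ∂ν ≤ φ x := by
  have hpi : ENNReal.ofReal (2 * Real.pi) ≠ 0 := by simpa using Real.pi_pos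
  have hmeas : Measurable (Function.uncurry fun (θ : ℝ) (y : EuclideanSpace ℂ (Fin n)) =>
      φ (x + Complex.exp (θ * Complex.I) • (-y))) :=
    hm.comp (Continuous.measurable (by fun_prop))
  rw [← ENNReal.mul_le_mul_iff_right hpi ENNReal.ofReal_ne_top]
  calc ENNReal.ofReal (2 * Real.pi) * ∫⁻ y, φ (x - y) ∂ν
      = ∫⁻ θ in Set.Ioc (0 : ℝ) (2 * Real.pi), ∫⁻ y, φ (x - y) ∂ν := by
        rw [setLIntegral_const, Real.volume_Ioc, sub_zero, mul_comm]
    _ = ∫⁻ θ in Set.Ioc (0 : ℝ) (2 * Real.pi), ∫⁻ y,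
          φ (x + Complex.exp (θ * Complex.I) • (-y)) ∂ν := by
        refine lintegral_congr fun θ => ?_
        conv_lhs => rw [← hrot θ]
        rw [lintegral_map (f := fun y => φ (x - y)) (hm.comp (measurable_const.sub measurable_id))
          (Continuous.measurable (by fun_prop))]
        simp only [smul_neg, sub_eq_add_neg]
    _ = ∫⁻ y, (∫⁻ θ in Set.Ioc (0 : ℝ) (2 * Real.pi),
          φ (x + Complex.exp (θ * Complex.I) • (-y))) ∂ν :=
        lintegral_lintegral_swap hmeas.aemeasurable
    _ ≤ ∫⁻ _, ENNReal.ofReal (2 * Real.pi) * φ x ∂ν := by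
        refine lintegral_mono_ae (hν.mono fun y hy => hφ x (-y) fun ζ hζ => ?_)
        rw [smul_neg, ← sub_eq_add_neg]
        refine hx _ (lt_of_le_of_lt ?_ hy)
        rw [norm_smul]
        exact mul_le_of_le_one_left (norm_nonneg _) hζ
    _ = ENNReal.ofReal (2 * Real.pi) * φ x := by simp

theorem IsSupermean.comp_affine {n : ℕ} {D D₁ : Set (EuclideanSpace ℂ (Fin n))}
    {φ : EuclideanSpace ℂ (Fin n) → ENNReal} (hφ : IsSupermean D₁ φ)
    (z₀ : EuclideanSpace ℂ (Fin n)) (ρ : ℂ) (hD : ∀ x ∈ D, z₀ + ρ • (x - z₀) ∈ D₁) :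
    IsSupermean D fun x => φ (z₀ + ρ • (x - z₀)) := by
  intro z w h
  have key : ∀ ζ : ℂ, z₀ + ρ • (z + ζ • w - z₀) = z₀ + ρ • (z - z₀) + ζ • ρ • w := by
    intro ζ; rw [smul_comm ζ ρ, add_assoc, ← smul_add]; congr 2; abel
  simp only [key]
  exact hφ _ _ fun ζ hζ => by rw [← key]; exact hD _ (h ζ hζ)

/-- A continuous super-mean function with values in `[0, 1]` gives a plurisubharmonic function. -/
theorem IsSupermean.isPSH_neg_toReal {n : ℕ} {D : Set (EuclideanSpace ℂ (Fin n))}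
    {φ : EuclideanSpace ℂ (Fin n) → ENNReal} (hφ : IsSupermean D φ) (h1 : ∀ x, φ x ≤ 1)
    (hc : Continuous fun x => (φ x).toReal) (hne : D.Nonempty) :
    IsPSH D fun x => ((-(φ x).toReal : ℝ) : EReal) := by
  obtain ⟨a, ha⟩ := hne
  have h0 : ∀ x, ((-(φ x).toReal : ℝ) : EReal) ≤ 0 := fun x => by
    exact_mod_cast neg_nonpos.2 ENNReal.toReal_nonneg
  refine ⟨fun z _ => EReal.coe_lt_top _, ⟨a, ha, EReal.coe_ne_bot _⟩,
    (continuous_coe_real_ereal.comp hc.neg).upperSemicontinuous.upperSemicontinuousOn D, ?_⟩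
  intro z w h
  refine (le_circleMean_iff (u := fun x => ((-(φ x).toReal : ℝ) : EReal)) (h0 z) fun θ => h0 _).2 ?_
  have h2 : ∀ x, (-(((-(φ x).toReal : ℝ)) : EReal)).toENNReal = φ x := fun x => by
    rw [EReal.coe_neg, neg_neg, EReal.real_coe_toENNReal,
      ENNReal.ofReal_toReal ((h1 x).trans_lt ENNReal.one_lt_top).ne]
  simp only [h2]
  exact hφ z w h

/-- Continuous plurisubharmonic majorization at a point `z` of a bounded super-mean function which
is maximal on an open set `U`, keeping the extremal value on a given compact subset of `U`. -/
theorem IsSupermean.exists_continuous_psh {n : ℕ} {D U L : Set (EuclideanSpace ℂ (Fin n))}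
    (hDo : IsOpen D) (hDc : Convex ℝ D) {ψ : EuclideanSpace ℂ (Fin n) → ENNReal}
    (hψ : IsSupermean D ψ) (hm : Measurable ψ) (h1 : ∀ x, ψ x ≤ 1)
    (hU : IsOpen U) (hψU : ∀ x ∈ U, ψ x = 1) (hL : IsCompact L) (hLU : L ⊆ U)
    {z : EuclideanSpace ℂ (Fin n)} (hz : z ∈ D) :
    ∃ v : EuclideanSpace ℂ (Fin n) → ℝ, Continuous v ∧ IsPSH D (fun x => (v x : EReal)) ∧
      (∀ x, -1 ≤ v x) ∧ (∀ x, v x ≤ 0) ∧ -(ψ z).toReal ≤ v z ∧ ∀ x ∈ L, v x ≤ -1 := by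
  obtain ⟨s, hs, hsD⟩ := Metric.isOpen_iff.1 hDo z hz
  obtain ⟨η, hη, hηU⟩ := hL.exists_thickening_subset_open hU hLU
  obtain ⟨B, hB0, hB⟩ : ∃ B : ℝ, 0 < B ∧ ∀ x ∈ L, ‖x - z‖ ≤ B := by
    obtain ⟨B, hB0, hB⟩ := hL.isBounded.exists_pos_norm_le
    exact ⟨B + ‖z‖, by positivity, fun x hx => (norm_sub_le _ _).trans (by gcongr; exact hB x hx)⟩
  -- Contracting by `1 - t` towards `z` moves a point of `L` by at most `t * B`, and the kernel by
  -- less than `t * s` more; the total stays below `η`, hence inside `U`.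
  set t : ℝ := η / (2 * (B + s) + 2 * η) with ht
  have ht0 : 0 < t := by positivity
  have ht1 : t < 1 := by rw [ht, div_lt_one (by positivity)]; linarith
  have htη : t * (B + s) < η := by
    rw [ht, div_mul_eq_mul_div, div_lt_iff₀ (by positivity)]; nlinarith
  obtain ⟨ν, hνp, hνε, hrot, hcont⟩ := exists_circular_kernel n (mul_pos ht0 hs)
  let Φ : EuclideanSpace ℂ (Fin n) → ENNReal := fun x => ∫⁻ y, ψ (x - y) ∂ν
  let T : EuclideanSpace ℂ (Fin n) → EuclideanSpace ℂ (Fin n) :=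
    fun x => z + ((1 - t : ℝ) : ℂ) • (x - z)
  have hTz : T z = z := by simp [T]
  -- By convexity, since `T x - y = (1 - t) x + t (z - y / t)`. The contraction makes room for the
  -- convolution on all of `D`, and it fixes `z`, so nothing is lost there.
  have hT : ∀ x ∈ D, ∀ y, ‖y‖ < t * s → T x - y ∈ D := by
    intro x hx y hy
    have h2 : z - t⁻¹ • y ∈ D := by
      apply hsD
      rw [mem_ball_iff_norm, sub_sub_cancel_left, norm_neg, norm_smul, norm_inv,
        Real.norm_of_nonneg ht0.le, inv_mul_lt_iff₀ ht0]
      exact hy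
    have h3 := hDc hx h2 (sub_nonneg.2 ht1.le) ht0.le (by ring)
    convert h3 using 1
    simp only [T]
    rw [Complex.coe_smul, smul_sub t, smul_inv_smul₀ ht0.ne']
    module
  have hΦ1 : ∀ x, Φ x ≤ 1 := fun x => by
    calc Φ x ≤ ∫⁻ _, 1 ∂ν := MeasureTheory.lintegral_mono fun y => h1 _
      _ = 1 := by simp
  have hΦc : Continuous fun x => (Φ (T x)).toReal := (hcont ψ hm h1).comp (by fun_prop)
  have hsup : IsSupermean D fun x => Φ (T x) :=
    (hψ.convolution hm hνε (D₁ := {x | ∀ y, ‖y‖ < t * s → x - y ∈ D}) fun x hx => hx).comp_affine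
      z ((1 - t : ℝ) : ℂ) hT
  refine ⟨fun x => -(Φ (T x)).toReal, hΦc.neg,
    hsup.isPSH_neg_toReal (fun x => hΦ1 _) hΦc ⟨z, hz⟩, fun x => ?_, fun x => ?_, ?_, fun x hx => ?_⟩
  · have := ENNReal.toReal_mono ENNReal.one_ne_top (hΦ1 (T x))
    simpa using this
  · exact neg_nonpos.2 ENNReal.toReal_nonneg
  · rw [neg_le_neg_iff, hTz]
    refine ENNReal.toReal_mono ((h1 z).trans_lt ENNReal.one_lt_top).ne
      (hψ.convolution_le hm hνε hrot fun y hy => ?_)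
    have := hT z hz y hy
    rwa [hTz] at this
  · have h2 : Φ (T x) = 1 := by
      have h3 : ∀ᵐ y ∂ν, ψ (T x - y) = 1 := hνε.mono fun y hy => by
        refine hψU _ (hηU ?_)
        rw [Metric.mem_thickening_iff]
        refine ⟨x, hx, ?_⟩
        have e : T x - y - x = -(t • (x - z)) - y := by
          simp only [T]; rw [Complex.coe_smul]; module
        rw [dist_eq_norm, e]
        refine (norm_sub_le _ _).trans_lt ?_
        rw [norm_neg, norm_smul, Real.norm_of_nonneg ht0.le]
        nlinarith [hB x hx]
      simp only [Φ]
      rw [MeasureTheory.lintegral_congr_ae h3]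
      simp
    simp [h2]

/-! ### The sublevel sets and the slit domain -/

theorem UpperSemicontinuousOn.isOpen_sep_lt {α : Type*} [TopologicalSpace α] {u : α → EReal}
    {D : Set α} (hu : UpperSemicontinuousOn u D) (hD : IsOpen D) (c : EReal) :
    IsOpen {x ∈ D | u x < c} := by
  rw [isOpen_iff_mem_nhds]
  rintro x ⟨hx, hxc⟩
  have h := hu x hx c hxc
  rw [hD.nhdsWithin_eq hx] at h
  filter_upwards [h, hD.mem_nhds hx] with y h1 h2 using ⟨h2, h1⟩

open Classical in
theorem UpperSemicontinuousOn.measurable_ite {α : Type*} [TopologicalSpace α]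
    [MeasurableSpace α] [BorelSpace α] {u : α → EReal}
    {D : Set α} (hu : UpperSemicontinuousOn u D) (hD : IsOpen D) :
    Measurable fun x => if x ∈ D then u x else 0 := by
  refine measurable_of_Iio fun c => ?_
  have h : (fun x => if x ∈ D then u x else 0) ⁻¹' Set.Iio c =
      {x ∈ D | u x < c} ∪ {x | x ∉ D ∧ 0 < c} := by
    ext x
    by_cases hx : x ∈ D <;> simp [hx]
  rw [h]
  exact (hu.isOpen_sep_lt hD c).measurableSet.union
    (hD.measurableSet.compl.inter (MeasurableSet.const _))

theorem div_lt_neg_one_iff {x : EReal} {m : ℝ} (hm : 0 < m) :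
    x / (m : EReal) < -1 ↔ x < ((-m : ℝ) : EReal) := by
  rw [EReal.div_lt_iff (by exact_mod_cast hm) (EReal.coe_ne_top m), EReal.neg_mul, one_mul,
    EReal.coe_neg]

section Slit

variable {n : ℕ} {D V : Set (EuclideanSpace ℂ (Fin n))} {u : EuclideanSpace ℂ (Fin n) → EReal}
  {m : ℝ}

theorem sublevelSet_subset : sublevelSet V u m ⊆ V := Set.inter_subset_right

theorem isOpen_sublevelSet (hu : UpperSemicontinuousOn u D) (hD : IsOpen D) (hV : IsOpen V)
    (hVD : V ⊆ D) (hm : 0 < m) : IsOpen (sublevelSet V u m) := by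
  have h : sublevelSet V u m = {x ∈ D | u x < ((-m : ℝ) : EReal)} ∩ V := by
    ext x
    simp only [sublevelSet, Set.mem_inter_iff, Set.mem_ofPred_eq, div_lt_neg_one_iff hm]
    exact ⟨fun h => ⟨⟨hVD h.2, h.1⟩, h.2⟩, fun h => ⟨h.1.2, h.2⟩⟩
  rw [h]
  exact (hu.isOpen_sep_lt hD _).inter hV

theorem closure_subset_closure_sublevelSet (hdense : V ⊆ closure {z ∈ V | u z = ⊥})
    (hm : 0 < m) : closure V ⊆ closure (sublevelSet V u m) := by
  refine closure_minimal (hdense.trans (closure_mono ?_)) isClosed_closure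
  rintro z ⟨hz, hzb⟩
  refine ⟨?_, hz⟩
  rw [Set.mem_ofPred_eq, div_lt_neg_one_iff hm, hzb]
  exact EReal.bot_lt_coe _

theorem isOpen_slitDomain (hD : IsOpen D) : IsOpen (slitDomain D V u m) :=
  hD.sdiff isClosed_frontier

theorem slitDomain_subset : slitDomain D V u m ⊆ D := Set.sdiff_subset

theorem sdiff_closure_subset_slitDomain : D \ closure V ⊆ slitDomain D V u m := fun _ hz =>
  ⟨hz.1, fun h => hz.2 (closure_mono sublevelSet_subset (frontier_subset_closure h))⟩

theorem sublevelSet_subset_slitDomain (hU : IsOpen (sublevelSet V u m)) (hVD : V ⊆ D) :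
    sublevelSet V u m ⊆ slitDomain D V u m := fun _ hz =>
  ⟨hVD hz.2, fun h => by rw [hU.frontier_eq] at h; exact h.2 hz⟩

/-- Removing `∂U_m` leaves `U_m` equal to the trace of its closure. This makes `g_m` continuous and
`K ∩ U_m` compact for compact `K`. -/
theorem isClopen_preimage_sublevelSet (hU : IsOpen (sublevelSet V u m)) :
    IsClopen ((↑) ⁻¹' sublevelSet V u m : Set (slitDomain D V u m)) := by
  have h : ((↑) ⁻¹' sublevelSet V u m : Set (slitDomain D V u m)) =
      (↑) ⁻¹' closure (sublevelSet V u m) := by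
    ext x
    refine ⟨fun h => subset_closure h, fun h => ?_⟩
    by_contra hx
    exact x.2.2 (by rw [hU.frontier_eq]; exact ⟨h, hx⟩)
  exact ⟨h ▸ isClosed_closure.preimage continuous_subtype_val, hU.preimage continuous_subtype_val⟩

theorem continuous_negChar (hU : IsOpen (sublevelSet V u m)) :
    Continuous (negChar (slitDomain D V u m) (sublevelSet V u m)) := by
  have h : negChar (slitDomain D V u m) (sublevelSet V u m) =
      fun z => -(((↑) ⁻¹' sublevelSet V u m : Set (slitDomain D V u m)).indicator 1 z) := rfl
  rw [h]
  refine (continuous_indicator (fun a ha => ?_) continuousOn_const).neg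
  rw [(isClopen_preimage_sublevelSet hU).frontier_eq] at ha
  exact ha.elim

theorem neg_one_le_negChar {D' U : Set (EuclideanSpace ℂ (Fin n))} (z : D') :
    -1 ≤ negChar D' U z := by
  unfold negChar
  exact neg_le_neg (Set.indicator_apply_le' (fun _ => le_rfl) fun _ => zero_le_one)

theorem negChar_nonpos {D' U : Set (EuclideanSpace ℂ (Fin n))} (z : D') :
    negChar D' U z ≤ 0 :=
  neg_nonpos.2 (Set.indicator_nonneg (fun _ _ => zero_le_one) _)

end Slit

/-! ### The cone of continuous plurisubharmonic functions -/

section Cone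

open MeasureTheory

variable {n : ℕ} {D : Set (EuclideanSpace ℂ (Fin n))}

theorem circleMean_coe {v : EuclideanSpace ℂ (Fin n) → ℝ} {z w : EuclideanSpace ℂ (Fin n)}
    (hv : IntegrableOn (fun θ : ℝ => v (z + Complex.exp (θ * Complex.I) • w))
      (Set.Ioc 0 (2 * Real.pi))) :
    circleMean (fun x => (v x : EReal)) z w =
      (((∫ θ in Set.Ioc (0 : ℝ) (2 * Real.pi), v (z + Complex.exp (θ * Complex.I) • w)) /
        (2 * Real.pi) : ℝ) : EReal) := by
  have h1 := hv.lintegral_lt_top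
  have h2 := hv.neg.lintegral_lt_top
  simp only [Pi.neg_apply] at h2
  rw [integral_eq_lintegral_pos_part_sub_lintegral_neg_part hv]
  simp only [circleMean, ← EReal.coe_neg, EReal.real_coe_toENNReal]
  rw [EReal.coe_div, EReal.coe_sub, EReal.coe_ennreal_toReal h1.ne,
    EReal.coe_ennreal_toReal h2.ne]

theorem integrableOn_circle {v : EuclideanSpace ℂ (Fin n) → ℝ} (hv : ContinuousOn v D)
    {z w : EuclideanSpace ℂ (Fin n)} (h : ∀ ζ : ℂ, ‖ζ‖ ≤ 1 → z + ζ • w ∈ D) :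
    IntegrableOn (fun θ : ℝ => v (z + Complex.exp (θ * Complex.I) • w))
      (Set.Ioc 0 (2 * Real.pi)) := by
  have hc : Continuous fun θ : ℝ => v (z + Complex.exp (θ * Complex.I) • w) :=
    hv.comp_continuous (by fun_prop) (circle_mem h)
  exact (hc.integrableOn_Icc).mono_set Set.Ioc_subset_Icc_self

/-- For continuous `v` the extended mean is a Bochner integral, so linearity of the integral yields
the cone properties. -/
theorem isPSH_coe_iff {v : EuclideanSpace ℂ (Fin n) → ℝ} (hv : ContinuousOn v D)
    (hne : D.Nonempty) :
    IsPSH D (fun x => (v x : EReal)) ↔ ∀ z w : EuclideanSpace ℂ (Fin n),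
      (∀ ζ : ℂ, ‖ζ‖ ≤ 1 → z + ζ • w ∈ D) → 2 * Real.pi * v z ≤
        ∫ θ in Set.Ioc (0 : ℝ) (2 * Real.pi), v (z + Complex.exp (θ * Complex.I) • w) := by
  have key : ∀ z w : EuclideanSpace ℂ (Fin n), (∀ ζ : ℂ, ‖ζ‖ ≤ 1 → z + ζ • w ∈ D) →
      ((v z : EReal) ≤ circleMean (fun x => (v x : EReal)) z w ↔ 2 * Real.pi * v z ≤
        ∫ θ in Set.Ioc (0 : ℝ) (2 * Real.pi), v (z + Complex.exp (θ * Complex.I) • w)) := by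
    intro z w h
    rw [circleMean_coe (integrableOn_circle hv h), EReal.coe_le_coe_iff,
      le_div_iff₀ Real.two_pi_pos, mul_comm]
  refine ⟨fun H z w h => (key z w h).1 (H.submean z w h), fun H => ?_⟩
  obtain ⟨a, ha⟩ := hne
  exact ⟨fun z _ => EReal.coe_lt_top _, ⟨a, ha, EReal.coe_ne_bot _⟩,
    (continuous_coe_real_ereal.comp_continuousOn hv).upperSemicontinuousOn,
    fun z w h => (key z w h).2 (H z w h)⟩

theorem isConeWithConstants_pshContCone {D' : Set (EuclideanSpace ℂ (Fin n))}
    (hne : D.Nonempty) (hD' : D' ⊆ D) : IsConeWithConstants (pshContCone D D') where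
  continuous := by
    rintro f ⟨v, hv, -, hf⟩
    rw [funext hf]
    exact hv.comp_continuous continuous_subtype_val fun z => subset_closure (hD' z.2)
  add_mem := by
    rintro f ⟨v, hv, hvp, hf⟩ g ⟨w, hw, hwp, hg⟩
    refine ⟨fun x => v x + w x, hv.add hw, ?_, fun z => by simp [hf, hg]⟩
    have hv' := hv.mono subset_closure
    have hw' := hw.mono subset_closure
    rw [isPSH_coe_iff hv' hne] at hvp
    rw [isPSH_coe_iff hw' hne] at hwp
    refine (isPSH_coe_iff (hv'.add hw') hne).2 ?_
    intro z y h
    simp only [Pi.add_apply]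
    rw [integral_add (integrableOn_circle hv' h) (integrableOn_circle hw' h), mul_add]
    exact add_le_add (hvp z y h) (hwp z y h)
  smul_mem := by
    rintro c hc f ⟨v, hv, hvp, hf⟩
    refine ⟨fun x => c * v x, continuousOn_const.mul hv, ?_, fun z => by simp [hf]⟩
    have hv' := hv.mono subset_closure
    rw [isPSH_coe_iff hv' hne] at hvp
    refine (isPSH_coe_iff (v := fun x => c * v x) (continuousOn_const.mul hv') hne).2 ?_
    intro z y h
    rw [integral_const_mul, mul_left_comm]
    exact mul_le_mul_of_nonneg_left (hvp z y h) hc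
  const_mem c := by
    refine ⟨fun _ => c, continuousOn_const, ?_, fun _ => rfl⟩
    rw [isPSH_coe_iff (v := fun _ => c) continuousOn_const hne]
    intro z y h
    simp [Real.pi_pos.le]

end Cone

/-! ### Bounds for the two sides of the duality -/

section Duality

open MeasureTheory

variable {n : ℕ} {D V : Set (EuclideanSpace ℂ (Fin n))} {u : EuclideanSpace ℂ (Fin n) → EReal}
  {m : ℝ}

theorem edwardsSup_ne_bot {X : Type*} [TopologicalSpace X] {F : Set (X → ℝ)}
    (hF : IsConeWithConstants F) {g : X → ℝ} {c : ℝ} (hg : ∀ x, c ≤ g x) (z : X) :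
    edwardsSup F g z ≠ ⊥ := by
  have h : (c : EReal) ≤ edwardsSup F g z := le_sSup ⟨_, hF.const_mem c, hg, rfl⟩
  exact fun hb => EReal.coe_ne_bot c (le_bot_iff.1 (hb ▸ h))

/-- Continuity up to `closure D` spreads the bound `-1` from `U_m` to `closure V`, which includes
every point of `D` removed in the slit domain. -/
theorem edwardsSup_le_relExtremal (hU : IsOpen (sublevelSet V u m))
    (hVD : V ⊆ D) (hdense : V ⊆ closure {z ∈ V | u z = ⊥}) (hm : 0 < m)
    (z : slitDomain D V u m) :
    edwardsSup (pshContCone D (slitDomain D V u m))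
      (negChar (slitDomain D V u m) (sublevelSet V u m)) z ≤ relExtremal D V z := by
  refine sSup_le ?_
  rintro t ⟨f, ⟨v, hv, hvp, hf⟩, hfg, rfl⟩
  refine le_sSup ⟨fun x => (v x : EReal), hvp, fun x hx => ?_, by rw [hf]⟩
  rw [EReal.coe_le_coe_iff]
  by_cases hxV : x ∈ closure V
  · have hle : v x ≤ -1 := by
      have hsub : ∀ y ∈ sublevelSet V u m, v y ≤ -1 := fun y hy => by
        have h1 := hfg ⟨y, sublevelSet_subset_slitDomain hU hVD hy⟩
        rw [hf] at h1
        simpa [negChar, Set.indicator_of_mem hy] using h1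
      have hxU := closure_subset_closure_sublevelSet hdense hm hxV
      have hcx : ContinuousWithinAt v (sublevelSet V u m) x :=
        (hv x (subset_closure hx)).mono
          ((sublevelSet_subset.trans hVD).trans subset_closure)
      exact hcx.closure_le hxU continuousWithinAt_const hsub
    refine hle.trans (neg_le_neg (Set.indicator_apply_le' (fun _ => le_rfl) fun _ => zero_le_one))
  · have h1 := hfg ⟨x, sdiff_closure_subset_slitDomain ⟨hx, hxV⟩⟩
    rw [hf] at h1
    rw [Set.indicator_of_notMem fun h => hxV (subset_closure h), neg_zero]
    exact h1.trans (negChar_nonpos _)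

theorem div_le_edwardsInf (hDo : IsOpen D) (hDc : Convex ℝ D)
    (hu : IsPSH D u) (h0 : ∀ z ∈ D, u z ≤ 0) (hU : IsOpen (sublevelSet V u m))
    (hVD : V ⊆ D) (hm : 0 < m) (z : slitDomain D V u m) :
    u z / (m : EReal) ≤ edwardsInf (pshContCone D (slitDomain D V u m))
      (negChar (slitDomain D V u m) (sublevelSet V u m)) z := by
  classical
  refine le_sInf ?_
  rintro t ⟨μ, ⟨hμp, ⟨K, hK, hμK⟩, hμF⟩, rfl⟩
  -- On `D` this is `-max (u/m) (-1)`; the value off `D` serves only to make it globally measurable.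
  let ψ : EuclideanSpace ℂ (Fin n) → ENNReal := fun x =>
    min ((-(if x ∈ D then u x else 0)).toENNReal / ENNReal.ofReal m) 1
  have hm0 : ENNReal.ofReal m ≠ 0 := by simpa using hm
  have hψm : Measurable ψ := by
    have h1 := hu.usc.measurable_ite hDo
    exact ((((continuous_neg.measurable.comp h1).ereal_toENNReal)).div_const _).min
      measurable_const
  have hψ1 : ∀ x, ψ x ≤ 1 := fun x => min_le_right _ _
  have hψ : IsSupermean D ψ := by
    intro x w h
    have hx := center_mem h
    simp only [ψ, hx, circle_mem h, if_true]
    have h1 := hu.isSupermean h0 x w h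
    rw [mul_min]
    refine le_min ?_ ?_
    · calc _ ≤ ∫⁻ θ in Set.Ioc (0 : ℝ) (2 * Real.pi),
            (-(u (x + Complex.exp (θ * Complex.I) • w))).toENNReal / ENNReal.ofReal m :=
            lintegral_mono fun θ => min_le_left _ _
        _ = (∫⁻ θ in Set.Ioc (0 : ℝ) (2 * Real.pi),
            (-(u (x + Complex.exp (θ * Complex.I) • w))).toENNReal) / ENNReal.ofReal m := by
            simp only [div_eq_mul_inv]
            exact lintegral_mul_const' _ _ (ENNReal.inv_ne_top.2 hm0)
        _ ≤ _ := by
            rw [← mul_div_assoc]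
            exact ENNReal.div_le_div_right h1 _
    · calc _ ≤ ∫⁻ θ in Set.Ioc (0 : ℝ) (2 * Real.pi), (1 : ENNReal) :=
            lintegral_mono fun θ => min_le_right _ _
        _ = _ := by simp
  have hψU : ∀ x ∈ sublevelSet V u m, ψ x = 1 := by
    intro x hx
    refine min_eq_right ?_
    rw [if_pos (hVD hx.2), ENNReal.le_div_iff_mul_le (.inl hm0) (.inl ENNReal.ofReal_ne_top),
      one_mul]
    have h1 : u x < ((-m : ℝ) : EReal) := (div_lt_neg_one_iff hm).1 hx.1
    have h2 : (m : EReal) ≤ -(u x) := by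
      rw [EReal.le_neg, ← EReal.coe_neg]; exact h1.le
    exact EReal.toENNReal_le_toENNReal h2
  have hL : IsCompact ((↑) '' (K ∩ (↑) ⁻¹' sublevelSet V u m) : Set (EuclideanSpace ℂ (Fin n))) :=
    (hK.inter_right (isClopen_preimage_sublevelSet hU).isClosed).image continuous_subtype_val
  have hLU : ((↑) '' (K ∩ (↑) ⁻¹' sublevelSet V u m : Set (slitDomain D V u m)) :
      Set (EuclideanSpace ℂ (Fin n))) ⊆ sublevelSet V u m := by
    rintro _ ⟨x, hx, rfl⟩
    exact hx.2
  obtain ⟨v, hvc, hvp, hv1, hv0, hvz, hvL⟩ :=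
    hψ.exists_continuous_psh hDo hDc hψm hψ1 hU hψU hL hLU z.2.1
  have hle1 : v z ≤ ∫ x : slitDomain D V u m, v x ∂μ :=
    hμF (fun x => v x) ⟨v, hvc.continuousOn, hvp, fun _ => rfl⟩
  have hle2 : ∫ x : slitDomain D V u m, v x ∂μ ≤
      ∫ x, negChar (slitDomain D V u m) (sublevelSet V u m) x ∂μ := by
    have hK' : ∀ᵐ x ∂μ, x ∈ K := hμK
    refine integral_mono_ae ?_ ?_ (hK'.mono fun x hx => ?_)
    · refine Integrable.of_bound (C := 1)
        (hvc.comp continuous_subtype_val).measurable.aestronglyMeasurable (.of_forall fun x => ?_)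
      exact abs_le.2 ⟨hv1 _, (hv0 _).trans zero_le_one⟩
    · refine Integrable.of_bound (C := 1)
        (continuous_negChar hU).measurable.aestronglyMeasurable (.of_forall fun x => ?_)
      exact abs_le.2 ⟨neg_one_le_negChar _, (negChar_nonpos _).trans zero_le_one⟩
    -- On `K ∩ U_m` the regularized function is at most `-1 = g_m`; elsewhere `g_m = 0` and `v ≤ 0`
    -- suffices.
    · by_cases hxU : (x : EuclideanSpace ℂ (Fin n)) ∈ sublevelSet V u m
      · exact (hvL x ⟨x, ⟨hx, hxU⟩, rfl⟩).trans (neg_one_le_negChar _)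
      · simpa [negChar, Set.indicator_of_notMem hxU] using hv0 x
  have hz : u z / (m : EReal) ≤ ((-(ψ z).toReal : ℝ) : EReal) := by
    have h1 : ψ z * ENNReal.ofReal m ≤ (-(u z)).toENNReal := by
      refine (ENNReal.le_div_iff_mul_le (.inl hm0) (.inl ENNReal.ofReal_ne_top)).1 ?_
      simp only [ψ, z.2.1, if_true]
      exact min_le_left _ _
    rw [← EReal.coe_ennreal_le_coe_ennreal_iff, EReal.coe_toENNReal
      (by simpa using EReal.neg_le_neg_iff.2 (h0 z z.2.1)), EReal.le_neg, EReal.coe_ennreal_mul,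
      EReal.coe_ennreal_ofReal, max_eq_left hm.le,
      ← EReal.coe_ennreal_toReal ((hψ1 z).trans_lt ENNReal.one_lt_top).ne] at h1
    rw [EReal.div_le_iff_le_mul (by exact_mod_cast hm) (EReal.coe_ne_top m), EReal.coe_neg,
      mul_comm, EReal.neg_mul]
    exact h1
  exact hz.trans (EReal.coe_le_coe_iff.2 (hvz.trans (hle1.trans hle2)))

end Duality

/-! ### Failure of the duality for large `m` -/

theorem exists_lt_div_of_ne_bot {x t : EReal} (hx : x ≠ ⊥) (ht : t < 0) :
    ∃ M : ℝ, 0 < M ∧ ∀ m : ℝ, M ≤ m → t < x / (m : EReal) := by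
  obtain ⟨s, hts, hs⟩ := EReal.lt_iff_exists_real_btwn.1 ht
  have hs' : s < 0 := by exact_mod_cast hs
  induction x with
  | bot => exact (hx rfl).elim
  | top =>
    refine ⟨1, one_pos, fun m hm => ?_⟩
    rw [EReal.top_div_of_pos_ne_top (by exact_mod_cast one_pos.trans_le hm) (EReal.coe_ne_top m)]
    exact ht.trans EReal.zero_lt_top
  | coe r =>
    refine ⟨max 1 (r / s), by positivity, fun m hm => hts.trans_le ?_⟩
    have hm0 : 0 < m := one_pos.trans_le ((le_max_left _ _).trans hm)
    rw [← EReal.coe_div, EReal.coe_le_coe_iff, le_div_iff₀ hm0]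
    have h1 : r / s ≤ m := (le_max_right _ _).trans hm
    rw [div_le_iff_of_neg hs'] at h1
    linarith

/-- Otherwise the ball would be clopen, hence the whole space by connectedness, which is unbounded.
-/
theorem nonempty_ball_sdiff_closure {E : Type*} [NormedAddCommGroup E] [NormedSpace ℝ E]
    [Nontrivial E] {a : E} {R : ℝ} (hR : 0 < R) {V : Set E} (hV : closure V ⊆ Metric.ball a R) :
    (Metric.ball a R \ closure V).Nonempty := by
  by_contra h
  rw [Set.not_nonempty_iff_eq_empty, Set.sdiff_eq_empty] at h
  have heq : closure V = Metric.ball a R := hV.antisymm h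
  have hcl : IsClopen (Metric.ball a R) := ⟨heq ▸ isClosed_closure, Metric.isOpen_ball⟩
  rcases isClopen_iff.1 hcl with h1 | h1
  · exact (Metric.nonempty_ball.2 hR).ne_empty h1
  · exact NormedSpace.unbounded_univ ℝ E (h1 ▸ Metric.isBounded_ball)

theorem mainTheorem6 (n : ℕ) (hn : 1 ≤ n) (D V : Set (EuclideanSpace ℂ (Fin n)))
    (hD : ∃ (a : EuclideanSpace ℂ (Fin n)) (R : ℝ), 0 < R ∧ D = Metric.ball a R)
    (hV : ∃ (b : EuclideanSpace ℂ (Fin n)) (r : ℝ), 0 < r ∧ V = Metric.ball b r)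
    (hVD : closure V ⊆ D) :
    -- nonpositive PSH functions with dense `-∞` set in `V` exist
    (∃ u : EuclideanSpace ℂ (Fin n) → EReal,
      IsPSH D u ∧ (∀ z ∈ D, u z ≤ 0) ∧ V ⊆ closure {z ∈ V | u z = ⊥}) ∧
    -- `u_{D,V}` is negative off `closure V`
    (∀ z ∈ D \ closure V, relExtremal D V z < 0) ∧
    -- every such function gives a counterexample
    (∀ u : EuclideanSpace ℂ (Fin n) → EReal,
      IsPSH D u → (∀ z ∈ D, u z ≤ 0) → V ⊆ closure {z ∈ V | u z = ⊥} →
      -- the hypotheses of the duality theorem are met, and its first alternative does not occur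
      (∀ m : ℝ, 0 < m →
        IsOpen (slitDomain D V u m) ∧
        D \ closure V ⊆ slitDomain D V u m ∧
        IsConeWithConstants (pshContCone D (slitDomain D V u m)) ∧
        Continuous (negChar (slitDomain D V u m) (sublevelSet V u m)) ∧
        (∀ z : slitDomain D V u m,
          edwardsSup (pshContCone D (slitDomain D V u m))
            (negChar (slitDomain D V u m) (sublevelSet V u m)) z ≠ ⊥) ∧
        -- the duality would force `u / m ≤ u_{D,V}` off `closure V`
        ((∀ z : slitDomain D V u m,
          edwardsSup (pshContCone D (slitDomain D V u m))
              (negChar (slitDomain D V u m) (sublevelSet V u m)) z =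
            edwardsInf (pshContCone D (slitDomain D V u m))
              (negChar (slitDomain D V u m) (sublevelSet V u m)) z) →
          ∀ z ∈ D \ closure V, u z / (m : EReal) ≤ relExtremal D V z)) ∧
      -- the duality fails for all large `m`
      (∃ M : ℝ, 0 < M ∧ ∀ m : ℝ, M ≤ m →
        (∃ z : slitDomain D V u m,
          edwardsSup (pshContCone D (slitDomain D V u m))
              (negChar (slitDomain D V u m) (sublevelSet V u m)) z ≠
            edwardsInf (pshContCone D (slitDomain D V u m))
              (negChar (slitDomain D V u m) (sublevelSet V u m)) z) ∧
        ¬ NoncompactEdwards (slitDomain D V u m))) ∧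
    -- hence the non-compact duality theorem is false for bounded open sets
    ¬ (∀ D' : Set (EuclideanSpace ℂ (Fin n)), IsOpen D' → Bornology.IsBounded D' →
        NoncompactEdwards D') := by
  obtain ⟨a, R, hR, rfl⟩ := hD
  obtain ⟨b, r, hr, hVb⟩ := hV
  have hVo : IsOpen V := hVb ▸ Metric.isOpen_ball
  have hVne : V.Nonempty := hVb ▸ Metric.nonempty_ball.2 hr
  have hDo : IsOpen (Metric.ball a R) := Metric.isOpen_ball
  have hDc : Convex ℝ (Metric.ball a R) := convex_ball a R
  have hDne : (Metric.ball a R).Nonempty := Metric.nonempty_ball.2 hR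
  have hDb : Bornology.IsBounded (Metric.ball a R) := Metric.isBounded_ball
  have hVD' : V ⊆ Metric.ball a R := subset_closure.trans hVD
  have : Nonempty (Fin n) := ⟨⟨0, hn⟩⟩
  have hOne := nonempty_ball_sdiff_closure hR hVD
  -- From here on only openness, convexity, boundedness and nonemptiness of `D` and of `D \ closure
  -- V` matter, not the shape of the ball.
  generalize Metric.ball a R = D at *
  have hex := exists_psh_dense_bot ⟨0, hn⟩ hDb hDne hVo
  have hneg : ∀ z ∈ D \ closure V, relExtremal D V z < 0 := fun z hz =>
    relExtremal_neg hDo hDc.isPreconnected hVo hVD' hVne hz.1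
  have hduality : ∀ u : EuclideanSpace ℂ (Fin n) → EReal,
      IsPSH D u → (∀ z ∈ D, u z ≤ 0) → V ⊆ closure {z ∈ V | u z = ⊥} → ∀ m : ℝ, 0 < m →
      (∀ z : slitDomain D V u m,
        edwardsSup (pshContCone D (slitDomain D V u m))
            (negChar (slitDomain D V u m) (sublevelSet V u m)) z =
          edwardsInf (pshContCone D (slitDomain D V u m))
            (negChar (slitDomain D V u m) (sublevelSet V u m)) z) →
        ∀ z ∈ D \ closure V, u z / (m : EReal) ≤ relExtremal D V z := by
    intro u hu hu0 hdense m hm heq z hz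
    have hU := isOpen_sublevelSet hu.usc hDo hVo hVD' hm
    let z' : slitDomain D V u m := ⟨z, sdiff_closure_subset_slitDomain hz⟩
    calc u z / (m : EReal) ≤ _ := div_le_edwardsInf hDo hDc hu hu0 hU hVD' hm z'
      _ = _ := (heq z').symm
      _ ≤ _ := edwardsSup_le_relExtremal hU hVD' hdense hm z'
  have hfail : ∀ u : EuclideanSpace ℂ (Fin n) → EReal,
      IsPSH D u → (∀ z ∈ D, u z ≤ 0) → V ⊆ closure {z ∈ V | u z = ⊥} →
      ∃ M : ℝ, 0 < M ∧ ∀ m : ℝ, M ≤ m →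
        (∃ z : slitDomain D V u m,
          edwardsSup (pshContCone D (slitDomain D V u m))
              (negChar (slitDomain D V u m) (sublevelSet V u m)) z ≠
            edwardsInf (pshContCone D (slitDomain D V u m))
              (negChar (slitDomain D V u m) (sublevelSet V u m)) z) ∧
        ¬ NoncompactEdwards (slitDomain D V u m) := by
    intro u hu hu0 hdense
    -- A single point off `closure V` with `u z ≠ -∞` refutes the inequality `u / m ≤ u_{D,V}` for
    -- all large `m`.
    obtain ⟨z, hz, hzb⟩ := hu.exists_ne_bot_of_isOpen hu0 hDo hDc.isPreconnected
      (hDo.sdiff isClosed_closure) Set.sdiff_subset hOne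
    obtain ⟨M, hM, h⟩ := exists_lt_div_of_ne_bot hzb (hneg z hz)
    refine ⟨M, hM, fun m hm => ?_⟩
    have hm0 : 0 < m := hM.trans_le hm
    have hne : ∃ z : slitDomain D V u m,
        edwardsSup (pshContCone D (slitDomain D V u m))
            (negChar (slitDomain D V u m) (sublevelSet V u m)) z ≠
          edwardsInf (pshContCone D (slitDomain D V u m))
            (negChar (slitDomain D V u m) (sublevelSet V u m)) z := by
      by_contra! heq
      exact (h m hm).not_ge (hduality u hu hu0 hdense m hm0 heq z hz)
    refine ⟨hne, fun hE => ?_⟩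
    obtain ⟨y, hy⟩ := hne
    have hcone := isConeWithConstants_pshContCone hDne (slitDomain_subset (V := V) (u := u) (m := m))
    rcases hE _ hcone _ (continuous_negChar (isOpen_sublevelSet hu.usc hDo hVo hVD' hm0))
      with h1 | h1
    · exact edwardsSup_ne_bot hcone neg_one_le_negChar y (h1 y)
    · exact hy (h1 y)
  refine ⟨hex, hneg, fun u hu hu0 hdense => ⟨fun m hm => ⟨isOpen_slitDomain hDo,
    sdiff_closure_subset_slitDomain, isConeWithConstants_pshContCone hDne slitDomain_subset,
    continuous_negChar (isOpen_sublevelSet hu.usc hDo hVo hVD' hm),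
    edwardsSup_ne_bot (isConeWithConstants_pshContCone hDne slitDomain_subset) neg_one_le_negChar,
    hduality u hu hu0 hdense m hm⟩, hfail u hu hu0 hdense⟩, fun hall => ?_⟩
  obtain ⟨u, hu, hu0, hdense⟩ := hex
  obtain ⟨M, -, h⟩ := hfail u hu hu0 hdense
  exact (h M le_rfl).2 (hall _ (isOpen_slitDomain hDo) (hDb.subset slitDomain_subset))
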